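/- Let $k\ge 0$, let $\Sigma_1,\dots,\Sigma_k$ be finite alphabets, and let $S=\Sigma_1^*\times\cdots\times\Sigma_k^*$ be the product monoid; the length of $s=(w_1,\dots,w_k)\in S$ is $|s|=|w_1|+\cdots+|w_k|$. A $k$-tape automaton $A$ consists of a finite set $Q$ of states, a set $E\subseteq Q\times\{s\in S:|s|=1\}\times Q$ of edges, and sets $Q_0,Q_f\subseteq Q$ of initial and final states. For $s\in S$, the multiplicity $A(s)$ is the number of runs of $A$ (paths of consecutive edges, including for each state the empty path at that state) from a state in $Q_0$ to a state in $Q_f$ whose label, i.e. the product in $S$ of the labels of its edges, is $s$. Two automata $A$ and $B$ over the same alphabets are multiplicity equivalent if $A(s)=B(s)$ for all $s\in S$. Let $F$ be a field of characteristic $0$, let $F\langle\Sigma_i\rangle$ be the free $F$-algebra on $\Sigma_i$, and let $R=F\langle\Sigma_1\rangle\otimes_F\cdots\otimes_F F\langle\Sigma_k\rangle$, where $s=(w_1,\dots,w_k)\in S$ is identified with $w_1\otimes\cdots\otimes w_k\in R$. For an automaton $A$ with states $q_1,\dots,q_m$, let $\alpha_A\in R^{1\times m}$ and $\eta_A\in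 R^{m\times 1}$ be the $0$-$1$ indicator vectors of the initial and the final states, and let $M_A\in M_m(R)$ have entries $(M_A)_{ij}=\sum_{(q_i,s,q_j)\in E}s$. For two $k$-tape automata $A$ and $B$ over the same alphabets put \[\alpha=(\alpha_A\;\;\alpha_B),\qquad M=\begin{pmatrix}M_A&0\\0&M_B\end{pmatrix},\qquad \eta=\begin{pmatrix}\eta_A\\-\eta_B\end{pmatrix},\] and let $n$ be the total number of states of $A$ and $B$. Then: 1. $A$ and $B$ are multiplicity equivalent if and only if $\alpha M^l\eta=0$ in $R$ for $l=0,1,\dots,n-1$. 2. $A$ and $B$ are multiplicity equivalent if and only if $A(s)=B(s)$ for all $s\in S$ of length at most $n-1$. -/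

import Mathlib

open scoped TensorProduct Matrix

noncomputable section

/-- The product monoid `S = Γ₁* × ⋯ × Γₖ*` of input tuples, multiplied by componentwise
concatenation. -/
abbrev TapeInput {k : ℕ} (Γ : Fin k → Type*) : Type _ :=
  ∀ i, FreeMonoid (Γ i)

namespace TapeInput

/-- The total length `|w₁| + ⋯ + |wₖ|` of an input tuple. -/
def length {k : ℕ} {Γ : Fin k → Type*} (s : TapeInput Γ) : ℕ :=
  ∑ i, (s i).length

theorem length_one {k : ℕ} {Γ : Fin k → Type*} : length (1 : TapeInput Γ) = 0 := by
  simp [length]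

theorem length_mul {k : ℕ} {Γ : Fin k → Type*} (s t : TapeInput Γ) :
    length (s * t) = length s + length t := by
  simp [length, Finset.sum_add_distrib]

end TapeInput

/-- The ring `F⟨Γ₁⟩ ⊗ ⋯ ⊗ F⟨Γₖ⟩` of polynomials in partially commuting variables. -/
abbrev PartiallyCommPoly (F : Type*) [Field F] {k : ℕ} (Γ : Fin k → Type*) : Type _ :=
  ⨂[F] i, FreeAlgebra F (Γ i)

/-- The monomial `w₁ ⊗ ⋯ ⊗ wₖ` of an input tuple `(w₁, …, wₖ)`. -/
def TapeInput.monomial (F : Type*) [Field F] {k : ℕ} {Γ : Fin k → Type*} (s : TapeInput Γ) :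
    PartiallyCommPoly F Γ :=
  PiTensorProduct.tprod F fun i => FreeMonoid.lift (FreeAlgebra.ι F) (s i)

/-- A nondeterministic multitape automaton with tape alphabets `Γ i` and state set `Q`; an edge
is a triple `(p, s, q)` where the input tuple `s` has total length one. (For finite alphabets and
finitely many states, every set of such triples is finite.) -/
structure MultitapeAutomaton {k : ℕ} (Γ : Fin k → Type*) (Q : Type*) where
  edges : Finset (Q × TapeInput Γ × Q)
  length_edge : ∀ e ∈ edges, e.2.1.length = 1
  initial : Set Q
  final : Set Q

namespace MultitapeAutomaton

/-- `A.IsRun p ρ q`: the sequence of edges `ρ` is a run of `A` from `p` to `q`. The empty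
sequence is a run from each state to itself. -/
def IsRun {k : ℕ} {Γ : Fin k → Type*} {Q : Type*} (A : MultitapeAutomaton Γ Q) :
    Q → List (Q × TapeInput Γ × Q) → Q → Prop
  | p, [], q => p = q
  | p, e :: ρ, q => e ∈ A.edges ∧ e.1 = p ∧ A.IsRun e.2.2 ρ q

/-- The label of a sequence of edges: the product in `S` of the labels of the edges. -/
def label {k : ℕ} {Γ : Fin k → Type*} {Q : Type*} (ρ : List (Q × TapeInput Γ × Q)) :
    TapeInput Γ :=
  (ρ.map fun e => e.2.1).prod

/-- The accepting runs with label `s`, each given with its first and its last state. -/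
def acceptingRuns {k : ℕ} {Γ : Fin k → Type*} {Q : Type*} (A : MultitapeAutomaton Γ Q)
    (s : TapeInput Γ) : Set (Q × List (Q × TapeInput Γ × Q) × Q) :=
  {r | r.1 ∈ A.initial ∧ r.2.2 ∈ A.final ∧ A.IsRun r.1 r.2.1 r.2.2 ∧ label r.2.1 = s}

theorem IsRun.forall_mem {k : ℕ} {Γ : Fin k → Type*} {Q : Type*} {A : MultitapeAutomaton Γ Q}
    {p q : Q} {ρ : List (Q × TapeInput Γ × Q)} (h : A.IsRun p ρ q) : ∀ e ∈ ρ, e ∈ A.edges := by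
  induction ρ generalizing p with
  | nil => simp
  | cons e ρ ih =>
    obtain ⟨h1, -, h3⟩ := h
    intro f hf
    rcases List.mem_cons.1 hf with rfl | hf
    · exact h1
    · exact ih h3 f hf

theorem IsRun.length_label {k : ℕ} {Γ : Fin k → Type*} {Q : Type*} {A : MultitapeAutomaton Γ Q}
    {p q : Q} {ρ : List (Q × TapeInput Γ × Q)} (h : A.IsRun p ρ q) :
    (label ρ).length = ρ.length := by
  induction ρ generalizing p with
  | nil => simpa [label] using TapeInput.length_one
  | cons e ρ ih =>
    obtain ⟨h1, -, h3⟩ := h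
    have h2 : label (e :: ρ) = e.2.1 * label ρ := by simp [label]
    rw [h2, TapeInput.length_mul, A.length_edge e h1, ih h3, List.length_cons, add_comm]

/-- There are only finitely many accepting runs on each input. -/
theorem finite_acceptingRuns {k : ℕ} {Γ : Fin k → Type*} {Q : Type*} [Finite Q]
    (A : MultitapeAutomaton Γ Q) (s : TapeInput Γ) : (A.acceptingRuns s).Finite := by
  have hL : {ρ : List (Q × TapeInput Γ × Q) |
      (∀ e ∈ ρ, e ∈ A.edges) ∧ ρ.length = s.length}.Finite := by
    refine ((List.finite_length_eq A.edges s.length).image (List.map Subtype.val)).subset ?_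
    rintro ρ ⟨h1, h2⟩
    refine ⟨ρ.attach.map fun e => ⟨e.1, h1 e.1 e.2⟩, by simpa using h2, ?_⟩
    rw [List.map_map]
    exact List.attach_map_subtype_val ρ
  refine (Set.finite_univ.prod (hL.prod Set.finite_univ)).subset ?_
  rintro ⟨p, ρ, q⟩ ⟨-, -, h3, h4⟩
  refine ⟨trivial, ⟨h3.forall_mem, ?_⟩, trivial⟩
  rw [← h4, h3.length_label]

/-- The multiplicity `A(s)`: the number of accepting runs of `A` with label `s`. -/
def multiplicity {k : ℕ} {Γ : Fin k → Type*} {Q : Type*} (A : MultitapeAutomaton Γ Q)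
    (s : TapeInput Γ) : ℕ :=
  (A.acceptingRuns s).ncard

/-- Multiplicity equivalence: `A(s) = B(s)` for every input tuple `s`. -/
def MultiplicityEquivalent {k : ℕ} {Γ : Fin k → Type*} {Q Q' : Type*}
    (A : MultitapeAutomaton Γ Q) (B : MultitapeAutomaton Γ Q') : Prop :=
  ∀ s : TapeInput Γ, A.multiplicity s = B.multiplicity s

end MultitapeAutomaton

/-- A weighted automaton `(α, M, η)` over a one-letter alphabet, with weights in `R` and state
set `Q`. -/
structure UnaryWeightedAutomaton (R Q : Type*) where
  α : Q → R
  M : Matrix Q Q R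
  η : Q → R

/-- The weight `α Mˡ η` of the word of length `l`. -/
def UnaryWeightedAutomaton.weight {R Q : Type*} [Semiring R] [Fintype Q] [DecidableEq Q]
    (W : UnaryWeightedAutomaton R Q) (l : ℕ) : R :=
  W.α ⬝ᵥ (W.M ^ l *ᵥ W.η)

namespace MultitapeAutomaton

open Classical in
/-- The weighted automaton of a multitape automaton: `α` and `η` are the `0`-`1`-vectors of the
initial and of the final states, and `M p q` is the sum of the labels of the edges from `p`
to `q`. -/
def toWeighted (F : Type*) [Field F] {k : ℕ} {Γ : Fin k → Type*} {Q : Type*}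
    (A : MultitapeAutomaton Γ Q) : UnaryWeightedAutomaton (PartiallyCommPoly F Γ) Q where
  α := fun q => if q ∈ A.initial then 1 else 0
  M := fun p q => ∑ e ∈ A.edges with e.1 = p ∧ e.2.2 = q, e.2.1.monomial F
  η := fun q => if q ∈ A.final then 1 else 0

/-- The combined weighted automaton `α = (α_A, α_B)`, `M = diag(M_A, M_B)`, `η = (η_A, -η_B)`. -/
def combine (F : Type*) [Field F] {k : ℕ} {Γ : Fin k → Type*} {Q Q' : Type*}
    (A : MultitapeAutomaton Γ Q) (B : MultitapeAutomaton Γ Q') :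
    UnaryWeightedAutomaton (PartiallyCommPoly F Γ) (Q ⊕ Q') where
  α := Sum.elim (A.toWeighted F).α (B.toWeighted F).α
  M := Matrix.fromBlocks (A.toWeighted F).M 0 0 (B.toWeighted F).M
  η := Sum.elim (A.toWeighted F).η (-(B.toWeighted F).η)

end MultitapeAutomaton

end

/-! The coefficient of `α Mˡ η` at `s` is `A(s) - B(s)` if `|s| = l` and `0` otherwise, and `F[S]`
embeds in the tensor product. Hence both claims say that all weights vanish once the first `n` do.
Over a field this would follow from a linear dependence among `α, αM, …, αMⁿ`. The same argument
works over any domain with the strong rank condition (no injective linear map `Rⁿ⁺¹ → Rⁿ`). `F[S]`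
itself can fail this condition: two letters of one tape generate a free left ideal of rank two. But
vanishing may be tested in a larger ring. Reading words as numerals in base `m` embeds `S` into a
power of a monoid of affine maps `x ↦ a + m ^ d * x`. That power has unique products, so its algebra
is a domain, and it has Følner sets, so a dimension count gives the strong rank condition. -/

open scoped TensorProduct Matrix

noncomputable section

/-! ### Weights over a domain with the strong rank condition -/

namespace UnaryWeightedAutomaton

/-- The image of a unary weighted automaton under a ring homomorphism. -/
@[simps]
def map {R R' Q : Type*} [Semiring R] [Semiring R'] (f : R →+* R')
    (W : UnaryWeightedAutomaton R Q) : UnaryWeightedAutomaton R' Q where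
  α := f ∘ W.α
  M := W.M.map f
  η := f ∘ W.η

theorem weight_map {R R' Q : Type*} [Semiring R] [Semiring R'] [Fintype Q] [DecidableEq Q]
    (f : R →+* R') (W : UnaryWeightedAutomaton R Q) (l : ℕ) :
    (W.map f).weight l = f (W.weight l) := by
  have h : f ∘ (W.M ^ l *ᵥ W.η) = (W.M.map f) ^ l *ᵥ (f ∘ W.η) := by
    funext q
    rw [Function.comp_apply, RingHom.map_mulVec, Matrix.map_pow]
  rw [weight, weight, RingHom.map_dotProduct, h]
  rfl

end UnaryWeightedAutomaton

/-- If `R` is a domain with the strong rank condition, a unary weighted automaton with `n` states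
whose first `n` weights vanish has only vanishing weights. -/
theorem UnaryWeightedAutomaton.weight_eq_zero_of_forall_lt_card {R Q : Type*} [Ring R] [IsDomain R]
    [StrongRankCondition R] [Fintype Q] [DecidableEq Q] (W : UnaryWeightedAutomaton R Q)
    (h : ∀ l < Fintype.card Q, W.weight l = 0) (l : ℕ) : W.weight l = 0 := by
  have hw : ∀ i r, (W.α ᵥ* W.M ^ i) ⬝ᵥ (W.M ^ r *ᵥ W.η) = W.weight (i + r) := fun i r => by
    rw [weight, ← Matrix.dotProduct_mulVec, Matrix.mulVec_mulVec, pow_add]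
  -- If these `n + 1` vectors were left independent, they would define an injective linear map `Rⁿ⁺¹
  -- → Rⁿ`.
  obtain ⟨c, hc, hc0⟩ : ∃ c : Fin (Fintype.card Q + 1) → R,
      ∑ i, c i • (W.α ᵥ* W.M ^ (i : ℕ)) = 0 ∧ c ≠ 0 := by
    by_contra! H
    have := card_le_of_injective R
      (Fintype.linearCombination R fun i : Fin (Fintype.card Q + 1) => W.α ᵥ* W.M ^ (i : ℕ))
      ((injective_iff_map_eq_zero _).2 fun c hc => H c (by
        simpa [Fintype.linearCombination_apply] using hc))
    simp at this
  -- With `j` the last index in the relation, pairing it with `Mʳ η` expresses `c j * weight (j +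
  -- r)` through earlier weights. Since `j ≤ n`, every `l ≥ n` has the form `j + r`.
  obtain ⟨j, hj, hjmax⟩ : ∃ j, c j ≠ 0 ∧ ∀ i, j < i → c i = 0 := by
    obtain ⟨i₀, hi₀⟩ := Function.ne_iff.1 hc0
    classical
    have hne : (Finset.univ.filter fun i => c i ≠ 0).Nonempty := ⟨i₀, by simpa using hi₀⟩
    refine ⟨_, (Finset.mem_filter.1 (Finset.max'_mem _ hne)).2, fun i hi => ?_⟩
    by_contra hci
    exact absurd (Finset.le_max' _ i (by simpa using hci)) (not_le.2 hi)
  induction l using Nat.strong_induction_on with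
  | _ l ih =>
    by_cases hl : l < Fintype.card Q
    · exact h l hl
    obtain ⟨r, rfl⟩ : ∃ r, l = j + r := Nat.exists_eq_add_of_le (by omega)
    have h1 := congrArg (· ⬝ᵥ (W.M ^ r *ᵥ W.η)) hc
    simp only [sum_dotProduct, smul_dotProduct, hw, zero_dotProduct, smul_eq_mul] at h1
    rw [Finset.sum_eq_single j ?_ (by simp)] at h1
    · exact (mul_eq_zero.1 h1).resolve_left hj
    · intro i _ hij
      rcases lt_or_gt_of_ne hij with hlt | hgt
      · rw [ih (i + r) (by have : (i : ℕ) < j := hlt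
                           omega), mul_zero]
      · rw [hjmax i hgt, zero_mul]

/-! ### Følner sets and the strong rank condition -/

open scoped Pointwise in
/-- A Følner condition: right translation of a suitable finite set by a given finite set increases
its size by a factor arbitrarily close to one. -/
def HasFolnerSets (G : Type*) [Mul G] : Prop :=
  ∀ [DecidableEq G] (K : Finset G) (n : ℕ), ∃ Ω : Finset G, n * (Ω * K).card < (n + 1) * Ω.card

open scoped Pointwise in
/-- The monoid algebra of a monoid with Følner sets satisfies the strong rank condition. -/
theorem HasFolnerSets.strongRankCondition {F G : Type*} [Field F] [Monoid G]
    (hG : HasFolnerSets G) : StrongRankCondition (MonoidAlgebra F G) := by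
  classical
  rw [strongRankCondition_iff_succ]
  intro n f hf
  -- `f` is left linear, so it multiplies by its matrix entries `v i j` on the right. With `K`
  -- containing their supports, vectors supported in `Ω` go to vectors supported in `Ω * K`.
  let v : Fin (n + 1) → Fin n → MonoidAlgebra F G := fun i => f (Pi.single i 1)
  have hv : ∀ x j, f x j = ∑ i, x i * v i j := fun x j => by
    conv_lhs => rw [← Finset.univ_sum_single x]
    rw [map_sum, Finset.sum_apply]
    refine Finset.sum_congr rfl fun i _ => ?_
    have : Pi.single i (x i) = x i • (Pi.single i 1 : Fin (n + 1) → MonoidAlgebra F G) := by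
      rw [← Pi.single_smul, smul_eq_mul, mul_one]
    rw [this, map_smul, Pi.smul_apply, smul_eq_mul]
  obtain ⟨Ω, hΩ⟩ := hG
    (Finset.univ.biUnion fun i => Finset.univ.biUnion fun j => (v i j).coeff.support) n
  set K := Finset.univ.biUnion fun i => Finset.univ.biUnion fun j => (v i j).coeff.support
  let e : (Fin (n + 1) → Ω → F) →ₗ[F] Fin (n + 1) → MonoidAlgebra F G :=
    LinearMap.pi fun i => (∑ ω : Ω,
      ((MonoidAlgebra.coeffLinearEquiv F).symm.toLinearMap ∘ₗ Finsupp.lsingle (ω : G)) ∘ₗ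
        LinearMap.proj ω) ∘ₗ LinearMap.proj i
  have he : ∀ c i, e c i = ∑ ω : Ω, MonoidAlgebra.single (ω : G) (c i ω) := fun c i => by
    simp [e]
  have hesupp : ∀ c i, (e c i).coeff.support ⊆ Ω := fun c i => by
    rw [he, MonoidAlgebra.coeff_sum]
    refine Finsupp.support_finsetSum.trans (Finset.biUnion_subset.2 fun ω _ => ?_)
    exact Finsupp.support_single_subset.trans (by simp)
  have heinj : Function.Injective e := by
    refine (injective_iff_map_eq_zero e).2 fun c hc => ?_
    ext i ω
    have := congrArg (fun y => (y i).coeff (ω : G)) hc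
    simpa [he, MonoidAlgebra.coeff_sum, Finsupp.finsetSum_apply, Finsupp.single_apply,
      Subtype.coe_inj] using this
  let g : (Fin (n + 1) → Ω → F) →ₗ[F] Fin n → (Ω * K : Finset G) → F :=
    (LinearMap.pi fun j => LinearMap.pi fun x => (Finsupp.lapply (x : G) ∘ₗ
      (MonoidAlgebra.coeffLinearEquiv F).toLinearMap) ∘ₗ LinearMap.proj j) ∘ₗ
      f.restrictScalars F ∘ₗ e
  have hg : ∀ c j x, g c j x = (f (e c) j).coeff (x : G) := fun c j x => rfl
  have hginj : Function.Injective g := by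
    refine (injective_iff_map_eq_zero g).2 fun c hc => heinj (hf ?_)
    rw [map_zero, map_zero]
    ext j x
    by_cases hx : x ∈ Ω * K
    · simpa [hg] using congrFun (congrFun hc j) ⟨x, hx⟩
    · by_contra hne
      refine hx ?_
      have : (f (e c) j).coeff.support ⊆ Ω * K := by
        rw [hv, MonoidAlgebra.coeff_sum]
        refine Finsupp.support_finsetSum.trans (Finset.biUnion_subset.2 fun i _ => ?_)
        refine (MonoidAlgebra.support_coeff_mul_subset _ _).trans (Finset.mul_subset_mul (hesupp c i) ?_)
        exact fun y hy => Finset.mem_biUnion.2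
          ⟨i, Finset.mem_univ _, Finset.mem_biUnion.2 ⟨j, Finset.mem_univ _, hy⟩⟩
      exact this (Finsupp.mem_support_iff.2 hne)
  -- The dimensions over `F` are `(n + 1) * |Ω|` and `n * |Ω * K|`, contrary to the choice of `Ω`.
  have := LinearMap.finrank_le_finrank_of_injective hginj
  simp only [Module.finrank_pi_fintype, Module.finrank_self, Finset.sum_const, Finset.card_univ,
    Fintype.card_coe, Fintype.card_fin, smul_eq_mul, mul_one] at this
  exact absurd hΩ (not_lt.2 this)

/-! ### The scaling monoid: order, Følner sets and numerals -/

/-- The monoid of pairs `(a, d)` with `(a, d) * (a', d') = (a + m ^ d * a', d + d')`: the affine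
maps `x ↦ a + m ^ d * x` of `ℕ`, together with their scaling exponents. -/
@[ext]
structure ScalingMonoid (m : ℕ) where
  shift : ℕ
  exponent : ℕ

namespace ScalingMonoid

variable {m : ℕ}

instance : Monoid (ScalingMonoid m) where
  mul x y := ⟨x.shift + m ^ x.exponent * y.shift, x.exponent + y.exponent⟩
  one := ⟨0, 0⟩
  mul_assoc x y z := ScalingMonoid.ext
    (show x.shift + m ^ x.exponent * y.shift + m ^ (x.exponent + y.exponent) * z.shift =
      x.shift + m ^ x.exponent * (y.shift + m ^ y.exponent * z.shift) by ring)
    (add_assoc _ _ _)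
  one_mul x := ScalingMonoid.ext (show 0 + m ^ 0 * x.shift = x.shift by simp) (zero_add _)
  mul_one x := ScalingMonoid.ext (show x.shift + m ^ x.exponent * 0 = x.shift by simp) (add_zero _)

@[simp] theorem shift_mul (x y : ScalingMonoid m) :
    (x * y).shift = x.shift + m ^ x.exponent * y.shift := rfl

@[simp] theorem exponent_mul (x y : ScalingMonoid m) :
    (x * y).exponent = x.exponent + y.exponent := rfl

@[simp] theorem shift_one : (1 : ScalingMonoid m).shift = 0 := rfl

@[simp] theorem exponent_one : (1 : ScalingMonoid m).exponent = 0 := rfl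

/-- The lexicographic order, in which the exponent comes first. -/
instance : LinearOrder (ScalingMonoid m) :=
  LinearOrder.lift' (fun x => toLex (x.exponent, x.shift)) fun x y h => by
    have h' := congrArg ofLex h
    simp only [ofLex_toLex, Prod.mk.injEq] at h'
    exact ScalingMonoid.ext h'.2 h'.1

theorem lt_iff {x y : ScalingMonoid m} :
    x < y ↔ x.exponent < y.exponent ∨ x.exponent = y.exponent ∧ x.shift < y.shift :=
  Prod.Lex.toLex_lt_toLex

instance : IsRightCancelMul (ScalingMonoid m) where
  mul_right_cancel x y z h := by
    have h1 := congrArg exponent h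
    have h2 := congrArg shift h
    simp only [exponent_mul, shift_mul, add_left_inj] at h1 h2
    rw [h1, add_left_inj] at h2
    exact ScalingMonoid.ext h2 h1

/-- Together with right cancellation this gives unique products in the scaling monoid, hence in its
finite powers, whose algebras over a field are therefore domains. -/
instance [NeZero m] : MulLeftStrictMono (ScalingMonoid m) where
  elim x y z h := by
    replace h := lt_iff.1 h
    refine lt_iff.2 ?_
    have := pow_pos (NeZero.pos m) x.exponent
    simp only [exponent_mul, shift_mul, add_lt_add_iff_left, add_right_inj]
    exact h.imp_right fun h => ⟨h.1, Nat.mul_lt_mul_of_pos_left h.2 this⟩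

/-- The elements `(a, d)` with `a < p` and `d < q`. -/
def box (m p q : ℕ) : Finset (ScalingMonoid m) :=
  (Finset.range p ×ˢ Finset.range q).map
    ⟨fun x => ⟨x.1, x.2⟩, fun x y h => by
      simp only [ScalingMonoid.mk.injEq] at h
      exact Prod.ext h.1 h.2⟩

theorem mem_box {p q : ℕ} {x : ScalingMonoid m} :
    x ∈ box m p q ↔ x.shift < p ∧ x.exponent < q := by
  simp only [box, Finset.mem_map, Finset.mem_product, Finset.mem_range,
    Prod.exists]
  exact ⟨by rintro ⟨a, b, h, rfl⟩; exact h, fun h => ⟨_, _, h, rfl⟩⟩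

theorem card_box (m p q : ℕ) : (box m p q).card = p * q := by simp [box]

/-- As `N → ∞`, `n * (1 + E / N) ^ r` tends to `n < n + 1`. -/
theorem exists_mul_add_pow_lt (n E r : ℕ) :
    ∃ N, n * (N + E) ^ r < (n + 1) * N ^ r := by
  have h : Filter.Tendsto (fun N : ℕ => (n : ℝ) * (1 + E / (N : ℝ)) ^ r) Filter.atTop
      (nhds (n * (1 + 0) ^ r)) :=
    (((tendsto_const_div_atTop_nhds_zero_nat (E : ℝ)).const_add 1).pow r).const_mul _
  obtain ⟨N, hN, hN0⟩ := ((h.eventually_lt_const (u := (n : ℝ) + 1) (by simp)).and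
    (Filter.eventually_gt_atTop 0)).exists
  refine ⟨N, ?_⟩
  have hN0' : (0 : ℝ) < N := by exact_mod_cast hN0
  have h2 := mul_lt_mul_of_pos_right hN (pow_pos hN0' r)
  rw [mul_assoc, ← mul_pow, add_mul, one_mul, div_mul_cancel₀ _ hN0'.ne'] at h2
  exact_mod_cast h2

-- On a box with exponents below `N` the scaling factors are at most `m ^ N`. Right multiplication
-- by `K` therefore extends a shift range of `m ^ N * N` by at most `m ^ N * E`, and the exponent
-- range by at most `E`. Each side grows by the factor `(N + E) / N`, and there are two sides per
-- coordinate.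
open scoped Pointwise in
theorem hasFolnerSets_pi [NeZero m] {ι : Type*} [Finite ι] :
    HasFolnerSets (ι → ScalingMonoid m) := by
  have := Fintype.ofFinite ι
  intro _ K n
  classical
  obtain ⟨E, hE⟩ : ∃ E, ∀ x ∈ K, ∀ i, (x i).shift ≤ E ∧ (x i).exponent ≤ E := by
    refine ⟨∑ x ∈ K, ∑ i, ((x i).shift + (x i).exponent), fun x hx i => ?_⟩
    have h1 := Finset.single_le_sum (f := fun i => (x i).shift + (x i).exponent)
      (fun _ _ => Nat.zero_le _) (Finset.mem_univ i)
    have h2 := Finset.single_le_sum (f := fun x => ∑ i, ((x i).shift + (x i).exponent))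
      (fun _ _ => Nat.zero_le _) hx
    omega
  obtain ⟨N, hN⟩ := exists_mul_add_pow_lt n E (2 * Fintype.card ι)
  refine ⟨Fintype.piFinset fun _ => box m (m ^ N * N) N, ?_⟩
  refine lt_of_le_of_lt (Nat.mul_le_mul_left n (Finset.card_le_card
    (t := Fintype.piFinset fun _ : ι => box m (m ^ N * (N + E)) (N + E)) ?_)) ?_
  · intro z hz
    obtain ⟨x, hx, y, hy, rfl⟩ := Finset.mem_mul.1 hz
    refine Fintype.mem_piFinset.2 fun i => mem_box.2 ?_
    obtain ⟨h1, h2⟩ := mem_box.1 (Fintype.mem_piFinset.1 hx i)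
    obtain ⟨h3, h4⟩ := hE y hy i
    have h5 : m ^ (x i).exponent * (y i).shift ≤ m ^ N * E :=
      Nat.mul_le_mul (Nat.pow_le_pow_right (NeZero.pos m) h2.le) h3
    simp only [Pi.mul_apply, shift_mul, exponent_mul, mul_add]
    omega
  simp only [Fintype.card_piFinset, card_box, Finset.prod_const, Finset.card_univ]
  have hpos : 0 < (m ^ N) ^ Fintype.card ι := pow_pos (pow_pos (NeZero.pos m) _) _
  calc n * (m ^ N * (N + E) * (N + E)) ^ Fintype.card ι
      = (m ^ N) ^ Fintype.card ι * (n * (N + E) ^ (2 * Fintype.card ι)) := by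
        rw [pow_mul, sq, mul_assoc, mul_pow]; ring
    _ < (m ^ N) ^ Fintype.card ι * ((n + 1) * N ^ (2 * Fintype.card ι)) :=
        Nat.mul_lt_mul_of_pos_left hN hpos
    _ = (n + 1) * (m ^ N * N * N) ^ Fintype.card ι := by
        rw [pow_mul, sq, mul_assoc (m ^ N), mul_pow (m ^ N)]; ring

/-- The words over an alphabet of digits less than `m`, read as numbers in base `m`. -/
def ofWord (m : ℕ) {X : Type*} (d : X → ℕ) : FreeMonoid X →* ScalingMonoid m :=
  FreeMonoid.lift fun x => ⟨d x, 1⟩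

theorem ofWord_eq {X : Type*} (d : X → ℕ) (w : FreeMonoid X) :
    ofWord m d w = ⟨Nat.ofDigits m (w.toList.map d), w.toList.length⟩ := by
  induction w using FreeMonoid.recOn with
  | one => simp; rfl
  | of_mul x w ih =>
    rw [map_mul, ih]
    ext
    · simp [ofWord, Nat.ofDigits_cons]
    · simp [ofWord, add_comm]

/-- The exponent records the length, so leading zeros are not lost and the numeral determines the
word. -/
theorem ofWord_injective (hm : 1 < m) {X : Type*} {d : X → ℕ} (hd : Function.Injective d)
    (hlt : ∀ x, d x < m) : Function.Injective (ofWord m d) := by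
  intro w w' h
  simp only [ofWord_eq, ScalingMonoid.mk.injEq] at h
  refine FreeMonoid.toList.injective (hd.list_map (Nat.ofDigits_inj_of_len_eq hm ?_ ?_ ?_ h.1))
  · simpa using h.2
  · simpa using fun x _ => hlt x
  · simpa using fun x _ => hlt x

end ScalingMonoid

/-! ### Transfer to the algebra of input tuples -/

/-- Tuples of words over finite alphabets embed into a power of a scaling monoid. -/
theorem exists_injective_monoidHom_scalingMonoid {k : ℕ} (Γ : Fin k → Type*) [∀ i, Finite (Γ i)] :
    ∃ (m : ℕ) (_ : NeZero m) (φ : TapeInput Γ →* (Fin k → ScalingMonoid m)),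
      Function.Injective φ := by
  obtain ⟨N, ⟨e⟩⟩ := Finite.exists_equiv_fin (Σ i, Γ i)
  -- One enumeration of all letters of all tapes supplies digits below `N`; adding `2` keeps the
  -- base above `1` even without letters.
  refine ⟨N + 2, inferInstance, MonoidHom.pi fun i =>
    (ScalingMonoid.ofWord (N + 2) fun x : Γ i => (e ⟨i, x⟩ : ℕ)).comp (Pi.evalMonoidHom _ i), ?_⟩
  intro s t h
  funext i
  refine ScalingMonoid.ofWord_injective (by omega) ?_ ?_ (congrFun h i)
  · intro x y hxy
    simpa using e.injective (Fin.ext hxy)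
  · intro x
    have := (e ⟨i, x⟩).isLt
    omega

/-- If the weights of a unary weighted automaton over `F[S]` with `n` states vanish on all words of
length less than `n`, they all vanish. -/
theorem UnaryWeightedAutomaton.monoidAlgebra_weight_eq_zero {F : Type*} [Field F] {k : ℕ}
    {Γ : Fin k → Type*} [∀ i, Finite (Γ i)] {Q : Type*} [Fintype Q] [DecidableEq Q]
    (W : UnaryWeightedAutomaton (MonoidAlgebra F (TapeInput Γ)) Q)
    (h : ∀ l < Fintype.card Q, W.weight l = 0) (l : ℕ) : W.weight l = 0 := by
  obtain ⟨m, hm, φ, hφ⟩ := exists_injective_monoidHom_scalingMonoid Γ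
  have := HasFolnerSets.strongRankCondition (F := F)
    (ScalingMonoid.hasFolnerSets_pi (m := m) (ι := Fin k))
  refine MonoidAlgebra.mapDomain_injective hφ ?_
  rw [MonoidAlgebra.mapDomain_zero]
  have hw := W.weight_map (MonoidAlgebra.mapDomainRingHom F φ)
  refine (hw l).symm.trans (weight_eq_zero_of_forall_lt_card _ (fun l hl => ?_) l)
  rw [hw, h l hl, map_zero]

/-! ### Matrix powers count runs -/

namespace MultitapeAutomaton

open Classical in
/-- The weighted automaton of a multitape automaton, with the labels interpreted by a map `f`
from input tuples to a semiring. -/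
def weighted {R : Type*} [Semiring R] {k : ℕ} {Γ : Fin k → Type*} {Q : Type*}
    (f : TapeInput Γ → R) (A : MultitapeAutomaton Γ Q) : UnaryWeightedAutomaton R Q where
  α := fun q => if q ∈ A.initial then 1 else 0
  M := fun p q => ∑ e ∈ A.edges with e.1 = p ∧ e.2.2 = q, f e.2.1
  η := fun q => if q ∈ A.final then 1 else 0

/-- The runs of length `l` from `p` to a final state, each given with its last state. -/
def finalRuns {k : ℕ} {Γ : Fin k → Type*} {Q : Type*} (A : MultitapeAutomaton Γ Q)
    (p : Q) (l : ℕ) : Set (List (Q × TapeInput Γ × Q) × Q) :=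
  {r | A.IsRun p r.1 r.2 ∧ r.2 ∈ A.final ∧ r.1.length = l}

theorem finite_finalRuns {k : ℕ} {Γ : Fin k → Type*} {Q : Type*} [Finite Q]
    (A : MultitapeAutomaton Γ Q) (p : Q) (l : ℕ) : (A.finalRuns p l).Finite := by
  have hL : {ρ : List (Q × TapeInput Γ × Q) | (∀ e ∈ ρ, e ∈ A.edges) ∧ ρ.length = l}.Finite := by
    refine ((List.finite_length_eq A.edges l).image (List.map Subtype.val)).subset ?_
    rintro ρ ⟨h1, h2⟩
    refine ⟨ρ.attach.map fun e => ⟨e.1, h1 e.1 e.2⟩, by simpa using h2, ?_⟩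
    rw [List.map_map]
    exact List.attach_map_subtype_val ρ
  exact (hL.prod Set.finite_univ).subset fun r hr => ⟨⟨hr.1.forall_mem, hr.2.2⟩, trivial⟩

theorem sum_finalRuns_succ {R : Type*} [AddCommMonoid R] {k : ℕ} {Γ : Fin k → Type*} {Q : Type*}
    [Finite Q] [DecidableEq Q] (A : MultitapeAutomaton Γ Q) (p : Q) (l : ℕ)
    (g : List (Q × TapeInput Γ × Q) → R) :
    ∑ r ∈ (A.finite_finalRuns p (l + 1)).toFinset, g r.1 =
      ∑ e ∈ A.edges with e.1 = p,
        ∑ r ∈ (A.finite_finalRuns e.2.2 l).toFinset, g (e :: r.1) := by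
  rw [Finset.sum_sigma']
  symm
  refine Finset.sum_bij (fun x _ => (x.1 :: x.2.1, x.2.2)) ?_ ?_ ?_ (fun _ _ => rfl)
  · rintro ⟨e, ρ, q⟩ h
    simp only [Finset.mem_sigma, Finset.mem_filter, Set.Finite.mem_toFinset] at h
    obtain ⟨⟨he, hp⟩, hr, hq, hl⟩ := h
    rw [Set.Finite.mem_toFinset]
    exact ⟨⟨he, hp, hr⟩, hq, by simpa using hl⟩
  · rintro ⟨e, ρ, q⟩ - ⟨e', ρ', q'⟩ - h
    simp only [Prod.mk.injEq, List.cons.injEq] at h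
    obtain ⟨⟨rfl, rfl⟩, rfl⟩ := h
    rfl
  · rintro ⟨ρ, q⟩ h
    rw [Set.Finite.mem_toFinset] at h
    obtain ⟨hr, hq, hl⟩ := h
    match ρ, hr, hl with
    | e :: ρ, hr, hl =>
      refine ⟨⟨e, ρ, q⟩, ?_, rfl⟩
      simp only [Finset.mem_sigma, Finset.mem_filter, Set.Finite.mem_toFinset]
      exact ⟨⟨hr.1, hr.2.1⟩, hr.2.2, hq, by simpa using hl⟩

/-- Each further factor `M` on the left prepends an edge, and `f` turns concatenation of labels into
products. -/
theorem pow_mulVec_weighted {R : Type*} [Semiring R] {k : ℕ} {Γ : Fin k → Type*} {Q : Type*}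
    [Fintype Q] [DecidableEq Q] (f : TapeInput Γ →* R) (A : MultitapeAutomaton Γ Q) (l : ℕ) (p : Q) :
    ((A.weighted f).M ^ l *ᵥ (A.weighted f).η) p =
      ∑ r ∈ (A.finite_finalRuns p l).toFinset, f (label r.1) := by
  classical
  induction l generalizing p with
  | zero =>
    have h : (A.finite_finalRuns p 0).toFinset = if p ∈ A.final then {([], p)} else ∅ := by
      ext ⟨ρ, q⟩
      rw [Set.Finite.mem_toFinset]
      constructor
      · rintro ⟨hr, hq, hl⟩
        obtain rfl := List.length_eq_zero_iff.1 hl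
        obtain rfl : p = q := hr
        rw [if_pos hq, Finset.mem_singleton]
      · split_ifs with hp
        · rw [Finset.mem_singleton]
          rintro ⟨rfl, rfl⟩
          exact ⟨rfl, hp, rfl⟩
        · simp
    rw [h, pow_zero, Matrix.one_mulVec]
    split_ifs with hp <;> simp [weighted, hp, label]
  | succ l ih =>
    rw [sum_finalRuns_succ A p l fun ρ => f (label ρ), pow_succ', ← Matrix.mulVec_mulVec,
      Matrix.mulVec, dotProduct]
    simp only [ih]
    simp only [weighted, Finset.sum_mul]
    -- The edges leaving `p` are grouped by target, matching the sum over the row `p` of `M`.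
    rw [← Finset.sum_fiberwise_of_maps_to (g := fun e : Q × TapeInput Γ × Q => e.2.2)
      (fun _ _ => Finset.mem_univ _)]
    refine Finset.sum_congr rfl fun q _ => ?_
    rw [Finset.filter_filter]
    refine Finset.sum_congr (by ext; simp) fun e he => ?_
    obtain ⟨-, -, rfl⟩ := Finset.mem_filter.1 he
    rw [Finset.mul_sum]
    refine Finset.sum_congr rfl fun r _ => ?_
    rw [← map_mul]
    simp [label]

/-- The coefficients of `α Mˡ η` over the monoid algebra of the input tuples. -/
theorem coeff_weight_weighted {F : Type*} [Field F] {k : ℕ} {Γ : Fin k → Type*} {Q : Type*}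
    [Fintype Q] [DecidableEq Q] (A : MultitapeAutomaton Γ Q) (l : ℕ) (s : TapeInput Γ) :
    ((A.weighted (MonoidAlgebra.of F (TapeInput Γ))).weight l).coeff s =
      if s.length = l then (A.multiplicity s : F) else 0 := by
  classical
  have h1 : ∀ p, (((A.weighted (MonoidAlgebra.of F (TapeInput Γ))).M ^ l *ᵥ
      (A.weighted (MonoidAlgebra.of F (TapeInput Γ))).η) p).coeff s =
      (((A.finite_finalRuns p l).toFinset.filter fun r => label r.1 = s).card : F) := fun p => by
    rw [pow_mulVec_weighted, MonoidAlgebra.coeff_sum, Finsupp.finsetSum_apply, Finset.card_filter,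
      Nat.cast_sum]
    refine Finset.sum_congr rfl fun r _ => ?_
    simp [MonoidAlgebra.of, Finsupp.single_apply]
  have h2 : ((A.weighted (MonoidAlgebra.of F (TapeInput Γ))).weight l).coeff s =
      ∑ p with p ∈ A.initial,
        (((A.finite_finalRuns p l).toFinset.filter fun r => label r.1 = s).card : F) := by
    rw [UnaryWeightedAutomaton.weight, dotProduct, MonoidAlgebra.coeff_sum,
      Finsupp.finsetSum_apply, Finset.sum_filter]
    refine Finset.sum_congr rfl fun p _ => ?_
    rw [← h1]
    simp only [weighted]
    split_ifs <;> simp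
  rw [h2, ← Nat.cast_sum, ← Finset.card_sigma]
  -- Edge labels have length one, so a run labelled `s` has exactly `|s|` edges: length `l` captures
  -- all of these runs or none.
  split_ifs with hs
  · congr 1
    rw [multiplicity, Set.ncard_eq_toFinset_card _ (A.finite_acceptingRuns s)]
    refine Finset.card_bij (fun x _ => (x.1, x.2)) ?_ ?_ ?_
    · rintro ⟨p, ρ, q⟩ h
      simp only [Finset.mem_sigma, Finset.mem_filter, Set.Finite.mem_toFinset] at h
      rw [Set.Finite.mem_toFinset]
      exact ⟨h.1.2, h.2.1.2.1, h.2.1.1, h.2.2⟩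
    · rintro ⟨p, r⟩ - ⟨p', r'⟩ - h
      simp only [Prod.mk.injEq] at h
      obtain ⟨rfl, rfl⟩ := h
      rfl
    · rintro ⟨p, ρ, q⟩ h
      rw [Set.Finite.mem_toFinset] at h
      obtain ⟨hp, hq, hr, hl⟩ := h
      refine ⟨⟨p, ρ, q⟩, ?_, rfl⟩
      simp only [Finset.mem_sigma, Finset.mem_filter, Set.Finite.mem_toFinset]
      refine ⟨⟨Finset.mem_univ _, hp⟩, ⟨hr, hq, ?_⟩, hl⟩
      rw [← hs, ← hl]
      exact hr.length_label.symm
  · rw [Finset.card_eq_zero.2, Nat.cast_zero]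
    rw [Finset.eq_empty_iff_forall_notMem]
    rintro ⟨p, ρ, q⟩ h
    simp only [Finset.mem_sigma, Finset.mem_filter, Set.Finite.mem_toFinset] at h
    refine hs ?_
    rw [← h.2.2, h.2.1.1.length_label]
    exact h.2.1.2.2

/-- The combined weighted automaton of two multitape automata, with the labels interpreted by a map
`f` from input tuples to a ring. -/
def combineWeighted {R : Type*} [Ring R] {k : ℕ} {Γ : Fin k → Type*} {Q Q' : Type*}
    (f : TapeInput Γ → R) (A : MultitapeAutomaton Γ Q) (B : MultitapeAutomaton Γ Q') :
    UnaryWeightedAutomaton R (Q ⊕ Q') where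
  α := Sum.elim (A.weighted f).α (B.weighted f).α
  M := Matrix.fromBlocks (A.weighted f).M 0 0 (B.weighted f).M
  η := Sum.elim (A.weighted f).η (-(B.weighted f).η)

theorem weight_combineWeighted {R : Type*} [Ring R] {k : ℕ} {Γ : Fin k → Type*} {Q Q' : Type*}
    [Fintype Q] [DecidableEq Q] [Fintype Q'] [DecidableEq Q'] (f : TapeInput Γ → R)
    (A : MultitapeAutomaton Γ Q) (B : MultitapeAutomaton Γ Q') (l : ℕ) :
    (combineWeighted f A B).weight l = (A.weighted f).weight l - (B.weighted f).weight l := by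
  simp only [UnaryWeightedAutomaton.weight, combineWeighted, Matrix.fromBlocks_diagonal_pow,
    Matrix.fromBlocks_mulVec, Matrix.zero_mulVec, Sum.elim_comp_inl, Sum.elim_comp_inr, zero_add, sumElim_dotProduct_sumElim, Matrix.mulVec_neg, dotProduct_neg, neg_zero,
    add_zero, sub_eq_add_neg]

/-- Characteristic zero makes equality of the multiplicities in `F` the same as equality in `ℕ`. -/
theorem weight_combineWeighted_eq_zero_iff {F : Type*} [Field F] [CharZero F] {k : ℕ}
    {Γ : Fin k → Type*} {Q Q' : Type*} [Fintype Q] [DecidableEq Q] [Fintype Q'] [DecidableEq Q']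
    (A : MultitapeAutomaton Γ Q) (B : MultitapeAutomaton Γ Q') (l : ℕ) :
    (combineWeighted (MonoidAlgebra.of F (TapeInput Γ)) A B).weight l = 0 ↔
      ∀ s : TapeInput Γ, s.length = l → A.multiplicity s = B.multiplicity s := by
  rw [weight_combineWeighted, ← MonoidAlgebra.coeff_eq_zero, Finsupp.ext_iff]
  refine forall_congr' fun s => ?_
  rw [sub_eq_add_neg, MonoidAlgebra.coeff_add, MonoidAlgebra.coeff_neg, ← sub_eq_add_neg,
    Finsupp.sub_apply, coeff_weight_weighted, coeff_weight_weighted]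
  split_ifs with hs <;> simp [hs, sub_eq_zero]

end MultitapeAutomaton

/-! ### The monoid algebra inside the tensor product -/

namespace TapeInput

/-- `TapeInput.monomial` as a monoid homomorphism. -/
@[simps]
def monomialHom (F : Type*) [Field F] {k : ℕ} (Γ : Fin k → Type*) :
    TapeInput Γ →* PartiallyCommPoly F Γ where
  toFun := monomial F
  map_one' := by
    simp only [monomial, Pi.one_apply, map_one]
    rfl
  map_mul' s t := by
    simp only [monomial, Pi.mul_apply, map_mul, PiTensorProduct.tprod_mul_tprod]
    rfl

/-- The coefficient of the monomial of `s`. -/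
def monomialCoeff (F : Type*) [Field F] {k : ℕ} {Γ : Fin k → Type*} (s : TapeInput Γ) :
    PartiallyCommPoly F Γ →ₗ[F] F :=
  PiTensorProduct.lift ((MultilinearMap.mkPiAlgebra F (Fin k) F).compLinearMap fun i =>
    (FreeAlgebra.basisFreeMonoid F (Γ i)).coord (s i))

theorem monomialCoeff_monomial (F : Type*) [Field F] {k : ℕ} {Γ : Fin k → Type*}
    [DecidableEq (TapeInput Γ)] (s t : TapeInput Γ) :
    monomialCoeff F s (monomial F t) = if t = s then 1 else 0 := by
  classical
  have h : ∀ i, FreeMonoid.lift (FreeAlgebra.ι F) (t i) =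
      FreeAlgebra.basisFreeMonoid F (Γ i) (t i) := fun i => by
    simp [FreeAlgebra.basisFreeMonoid, FreeAlgebra.equivMonoidAlgebraFreeMonoid]
  simp only [monomialCoeff, monomial, PiTensorProduct.lift.tprod, h,
    MultilinearMap.compLinearMap_apply, MultilinearMap.mkPiAlgebra_apply, Module.Basis.coord_apply,
    Module.Basis.repr_self, Finsupp.single_apply, Fintype.prod_boole, funext_iff]
  congr

/-- The canonical algebra homomorphism `F[S] → R`. -/
def toPartiallyCommPoly (F : Type*) [Field F] {k : ℕ} (Γ : Fin k → Type*) :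
    MonoidAlgebra F (TapeInput Γ) →ₐ[F] PartiallyCommPoly F Γ :=
  MonoidAlgebra.lift F _ _ (monomialHom F Γ)

/-- The functionals `monomialCoeff F s` recover every coefficient from the image. -/
theorem toPartiallyCommPoly_injective (F : Type*) [Field F] {k : ℕ} (Γ : Fin k → Type*) :
    Function.Injective (toPartiallyCommPoly F Γ) := by
  classical
  have h : ∀ s x, monomialCoeff F s (toPartiallyCommPoly F Γ x) = x.coeff s := fun s x => by
    rw [toPartiallyCommPoly, MonoidAlgebra.lift_apply, Finsupp.sum, map_sum]
    simp +contextual [monomialCoeff_monomial, eq_comm]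
  refine fun x y hxy => MonoidAlgebra.ext (Finsupp.ext fun s => ?_)
  rw [← h, ← h, hxy]

end TapeInput

/-! ### Change of coefficients and conclusion -/

theorem MultitapeAutomaton.map_combineWeighted {R R' : Type*} [Ring R] [Ring R'] (g : R →+* R')
    {k : ℕ} {Γ : Fin k → Type*} {Q Q' : Type*} (f : TapeInput Γ → R)
    (A : MultitapeAutomaton Γ Q) (B : MultitapeAutomaton Γ Q') :
    (combineWeighted f A B).map g = combineWeighted (g ∘ f) A B := by
  simp only [UnaryWeightedAutomaton.map, combineWeighted, UnaryWeightedAutomaton.mk.injEq]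
  refine ⟨?_, ?_, ?_⟩
  · funext q
    rcases q with q | q <;> simp [weighted, apply_ite g]
  · ext p q
    rcases p with p | p <;> rcases q with q | q
    · exact map_sum g _ _
    · exact map_zero g
    · exact map_zero g
    · exact map_sum g _ _
  · funext q
    rcases q with q | q <;> simp [weighted, apply_ite g]

open MultitapeAutomaton in
theorem proposition4 {F : Type*} [Field F] [CharZero F] {k : ℕ} {Γ : Fin k → Type*}
    [∀ i, Finite (Γ i)] {Q Q' : Type*} [Fintype Q] [DecidableEq Q] [Fintype Q'] [DecidableEq Q']
    (A : MultitapeAutomaton Γ Q) (B : MultitapeAutomaton Γ Q') (n : ℕ)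
    (hn : n = Fintype.card Q + Fintype.card Q') :
    (A.MultiplicityEquivalent B ↔ ∀ l < n, (A.combine F B).weight l = 0) ∧
      (A.MultiplicityEquivalent B ↔
        ∀ s : TapeInput Γ, s.length < n → A.multiplicity s = B.multiplicity s) := by
  have hweight : ∀ l, (A.combine F B).weight l = 0 ↔
      ∀ s : TapeInput Γ, s.length = l → A.multiplicity s = B.multiplicity s := fun l => by
    -- The given automaton is the image of one over `F[S]`; as `F[S]` embeds, both have the same
    -- vanishing weights.
    have h : A.combine F B = (combineWeighted (MonoidAlgebra.of F (TapeInput Γ)) A B).map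
        (TapeInput.toPartiallyCommPoly F Γ : _ →+* PartiallyCommPoly F Γ) := by
      rw [map_combineWeighted]
      have : TapeInput.monomial F = (TapeInput.toPartiallyCommPoly F Γ : _ →+* _) ∘
          MonoidAlgebra.of F (TapeInput Γ) := by
        funext s
        simp [TapeInput.toPartiallyCommPoly]
      rw [← this]
      rfl
    rw [h, UnaryWeightedAutomaton.weight_map, ← weight_combineWeighted_eq_zero_iff (F := F)]
    exact map_eq_zero_iff _ (TapeInput.toPartiallyCommPoly_injective F Γ)
  have hshort : (∀ l < n, (A.combine F B).weight l = 0) ↔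
      ∀ s : TapeInput Γ, s.length < n → A.multiplicity s = B.multiplicity s := by
    simp only [hweight]
    exact ⟨fun h s hs => h _ hs s rfl, fun h l hl s hs => h s (hs ▸ hl)⟩
  have hequiv : A.MultiplicityEquivalent B ↔
      ∀ s : TapeInput Γ, s.length < n → A.multiplicity s = B.multiplicity s := by
    refine ⟨fun h s _ => h s, fun h s => ?_⟩
    refine (weight_combineWeighted_eq_zero_iff (F := F) A B s.length).1 ?_ s rfl
    refine UnaryWeightedAutomaton.monoidAlgebra_weight_eq_zero _ (fun l hl => ?_) _
    rw [Fintype.card_sum, ← hn] at hl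
    exact (weight_combineWeighted_eq_zero_iff A B l).2 fun s hs => h s (hs ▸ hl)
  exact ⟨hequiv.trans hshort.symm, hequiv⟩

end
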